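/- Let $d\ge 1$. For $\eta\in U_d:=\{-1,0,1\}^d$ and a probability measure $\mu$ on $\mathbb{R}^d$ put $\mu_{\mathrm{sgn}}(\eta):=\mu(\{x:\mathrm{sign}(x)=\eta\})$ (signs taken coordinatewise), and let $V_d:=\{-1,1\}^d$. For $\eta,\eta'\in U_d$ write $\eta\preceq_s\eta'$ if $\eta_j=\eta'_j$ whenever $\eta_j\ne 0$. A probability measure $\lambda$ on $\mathbb{R}^d$ is obtained from a probability measure $\mu$ by an elementary operation if there are $q\ge 0$, $\eta\in U_d\setminus V_d$ and $\eta'\in U_d$ with $\eta\preceq_s\eta'$ such that $\mu_{\mathrm{sgn}}(\eta)\ge q$, $\lambda_{\mathrm{sgn}}(\eta)=\mu_{\mathrm{sgn}}(\eta)-q$, $\lambda_{\mathrm{sgn}}(\eta')=\mu_{\mathrm{sgn}}(\eta')+q$, and $\lambda_{\mathrm{sgn}}(\gamma)=\mu_{\mathrm{sgn}}(\gamma)$ for all other $\gamma\in U_d$. Write $\mu\preceq_{\mathrm{MCH}}\nu$ if $\nu$ is reached from $\mu$ by a finite sequence of elementary operations, and $\nu\in\mathrm{MCH}$ if the probability measure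 $\nu$ gives zero mass to $\{x: x_j=0\text{ for some }j\}$. The orthant median bias of a probability measure $\mu$ on $\mathbb{R}^d$ is $$\mathrm{OMB}(\mu):=\inf_{\nu\in\mathrm{MCH}:\ \mu\preceq_{\mathrm{MCH}}\nu}2^{d-1}\Bigl(\frac1{2^d}-\min_{A}\nu(A)\Bigr)_+,$$ the minimum being over the $2^d$ closed orthants $A$ of $\mathbb{R}^d$. Let $0<\alpha<1$ and define, for integers $B\ge 1$ and real $\delta$, $$U(B,\delta;d):=\sum_{\substack{1\le j\le d\\ j\text{ odd}}}\binom dj\Bigl((2^j-1)\Bigl(\tfrac1{2^j}-\tfrac{\delta}{2^{j-1}}\Bigr)^B+\Bigl(\tfrac1{2^j}+(2^j-1)\tfrac{\delta}{2^{j-1}}\Bigr)^B\Bigr)-\sum_{\substack{1\le j\le d\\ j\text{ even}}}\binom dj2^j\Bigl(\tfrac1{2^j}\Bigr)^B,$$ $$B_{\alpha,d}:=\bigl\lceil 1-\log_2\bigl(1-(1-\alpha)^{1/d}\bigr)\bigr\rceil,\qquad \tau_{\alpha,d}:=\frac{\alpha-U(B_{\alpha,d},0;d)}{U(B_{\alpha,d}-1,0;d)-U(B_{\alpha,d},0;d)}.$$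 Let $X_1,\dots,X_n$ be independent and identically distributed from $P$ on a measurable space $\mathcal X$, let $\mathcal A$ be a (measurable) estimation procedure that maps every finite sample from $\mathcal X$ to a point of $\mathbb{R}^d$, and let $\theta_0\in\mathbb{R}^d$. Let $\mathcal U$ be uniformly distributed on $[0,1]$, and set $B^*:=B_{\alpha,d}-1$ if $\mathcal U\le\tau_{\alpha,d}$ and $B^*:=B_{\alpha,d}$ otherwise. Given $B^*=b$, the data are randomly split into $b$ disjoint batches of equal size $\lfloor n/b\rfloor$ (the remaining observations are discarded): they are permuted by a random permutation and cut into consecutive blocks. The pair formed by $\mathcal U$ and the random permutation is independent of the data (the permutation may have any distribution, for instance the uniform one). Let $\widehat\theta^{(j)}$ be $\mathcal A$ applied to the $j$-th batch, $1\le j\le b$, and let the confidence region be the rectangular hull $$\widehat{\mathrm{CI}}_\alpha:=\prod_{i=1}^d\Bigl[\min_{1\le j\le B^*}\widehat\theta^{(j)}_i,\ \max_{1\le j\le B^*}\widehat\theta^{(j)}_i\Bigr].$$ Theorem. Let $\delta\in\mathbb{R}$. Suppose that, for every value $b$ that $B^*$ takes with positive probability and every $1\le j\le b$, the estimator $\widehat\theta^{(j)}$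 computed from the $j$-th of $b$ batches satisfies $\mathrm{OMB}\bigl(\mathcal L(\widehat\theta^{(j)}-\theta_0)\bigr)\le\delta$. Then $$\mathbb{P}\bigl(\theta_0\notin\widehat{\mathrm{CI}}_\alpha\bigr)\le\alpha+2^{d-1}B_{\alpha,d}(B_{\alpha,d}-1)\,\delta^2.$$ -/

import Mathlib

open MeasureTheory ProbabilityTheory

noncomputable section

namespace OrthantHulC

/-! ### Sign vectors, orthants and MCH distributions -/

/-- The set `U_d = {-1, 0, 1}^d` of sign vectors. -/
abbrev SignVec (d : ℕ) : Type := Fin d → SignType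

/-- The set `V_d = {-1, 1}^d` of sign vectors without a zero entry. -/
def fullSigns (d : ℕ) : Set (SignVec d) := {η | ∀ j, η j ≠ 0}

/-- The coordinatewise sign of a vector. -/
def signVec {d : ℕ} (x : Fin d → ℝ) : SignVec d := fun j => SignType.sign (x j)

/-- The closed orthant `{x : η_j x_j ≥ 0 for all j}`. -/
def orthant {d : ℕ} (η : SignVec d) : Set (Fin d → ℝ) := {x | ∀ j, 0 ≤ (η j : ℝ) * x j}

/-- `‖x‖₀`, the number of nonzero coordinates. -/
def zeroNorm {d : ℕ} (x : Fin d → ℝ) : ℕ := Nat.card {j : Fin d // x j ≠ 0}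

/-- The probability measure `Q` puts no mass on the set of vectors having a zero coordinate. -/
def IsMCH {d : ℕ} (Q : Measure (Fin d → ℝ)) : Prop :=
  IsProbabilityMeasure Q ∧ Q {x | zeroNorm x < d} = 0

/-- The orthant median bias of an MCH distribution (`d ≥ 1`):
`2^{d-1} (1/2^d - min_A ν(A))₊`, the minimum being over the `2^d` closed orthants `A`. -/
def orthantBias {d : ℕ} (ν : Measure (Fin d → ℝ)) : ℝ :=
  2 ^ (d - 1) * max (1 / 2 ^ d - ⨅ η : fullSigns d, ν.real (orthant (η : SignVec d))) 0

/-! ### The MCH ordering and the orthant median bias of a general distribution -/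

/-- The partial sign ordering. -/
def SignLE {d : ℕ} (η η' : SignVec d) : Prop :=
  (∀ j, η j ≠ 0 → η j = η' j) ∧ (∀ j, η j = 0 → (η j : ℝ) ≤ |(η' j : ℝ)|)

/-- The law of the sign vector: `μ_sgn(η) = μ {x : sign x = η}`. -/
def sgnMass {d : ℕ} (μ : Measure (Fin d → ℝ)) (η : SignVec d) : ℝ := μ.real {x | signVec x = η}

/-- The probability measure `lam` is obtained from the probability measure `μ` by an elementary
operation: some mass `q` is moved from the edge `η` to `η'`, where `η` precedes `η'`. -/
def ElementaryOp {d : ℕ} (μ lam : Measure (Fin d → ℝ)) : Prop :=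
  IsProbabilityMeasure μ ∧ IsProbabilityMeasure lam ∧
  ∃ q : ℝ, 0 ≤ q ∧ ∃ η η' : SignVec d, η ∉ fullSigns d ∧ SignLE η η' ∧
    (∀ γ : SignVec d, γ ≠ η → γ ≠ η' → sgnMass μ γ = sgnMass lam γ) ∧
    q ≤ sgnMass μ η ∧
    sgnMass lam η = sgnMass μ η - q ∧
    sgnMass lam η' = sgnMass μ η' + q

/-- The MCH ordering: `ν` is reached from `μ` by finitely many elementary operations. -/
def MCHLE {d : ℕ} (μ ν : Measure (Fin d → ℝ)) : Prop := Relation.ReflTransGen ElementaryOp μ ν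

/-- The orthant median bias of an arbitrary probability measure. -/
def OMB {d : ℕ} (μ : Measure (Fin d → ℝ)) : ℝ :=
  sInf {r : ℝ | ∃ ν : Measure (Fin d → ℝ), IsMCH ν ∧ MCHLE μ ν ∧ r = orthantBias ν}

/-! ### The rectangular hull confidence region -/

/-- The rectangular hull of `θ_1, …, θ_B` (used for `B ≥ 1` only). -/
def rectHull {d B : ℕ} (θ : Fin B → Fin d → ℝ) : Set (Fin d → ℝ) :=
  Set.univ.pi fun j => Set.Icc (⨅ k, θ k j) (⨆ k, θ k j)

/-- The function `U(B, δ; d)`. -/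
def upperU (B : ℕ) (δ : ℝ) (d : ℕ) : ℝ :=
  ∑ j ∈ (Finset.Icc 1 d).filter (fun j => Odd j), (d.choose j : ℝ) *
      (((2 : ℝ) ^ j - 1) * (1 / 2 ^ j - δ / 2 ^ (j - 1)) ^ B
        + (1 / 2 ^ j + ((2 : ℝ) ^ j - 1) * (δ / 2 ^ (j - 1))) ^ B)
    - ∑ j ∈ (Finset.Icc 1 d).filter (fun j => Even j),
        (d.choose j : ℝ) * 2 ^ j * (1 / 2 ^ j) ^ B

/-- `B_{α,d} = ⌈1 - log₂(1 - (1 - α)^{1/d})⌉`. -/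
def numBatches (α : ℝ) (d : ℕ) : ℕ :=
  ⌈1 - Real.logb 2 (1 - (1 - α) ^ (1 / (d : ℝ)))⌉₊

/-- The randomization threshold `τ_{α,d}`. -/
def tau (α : ℝ) (d : ℕ) : ℝ :=
  (α - upperU (numBatches α d) 0 d)
    / (upperU (numBatches α d - 1) 0 d - upperU (numBatches α d) 0 d)

/-- The randomized number `B^*` of batches, as a function of the value `u` of the uniform
random variable. -/
def Bstar (α : ℝ) (d : ℕ) (u : ℝ) : ℕ :=
  if u ≤ tau α d then numBatches α d - 1 else numBatches α d

/-- The position `j ⌊n/b⌋ + i` of the `i`-th element of the `j`-th of `b` consecutive blocks of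
equal size `⌊n/b⌋` in `{0, …, n - 1}`. -/
def blockIndex (n b : ℕ) (j : Fin b) (i : Fin (n / b)) : Fin n :=
  Fin.castLE (Nat.mul_div_le n b) (finProdFinEquiv (j, i))

/-- The estimator computed from the `j`-th of `b` disjoint batches of size `⌊n/b⌋`, where the
data `x` are split by permuting them by `σ` and cutting them into consecutive blocks; leftover
observations are discarded. `A m` is the estimation procedure on samples of size `m`. -/
def batchEstimator {𝒳 : Type*} {d n : ℕ} (A : (m : ℕ) → (Fin m → 𝒳) → Fin d → ℝ)
    (x : Fin n → 𝒳) (σ : Equiv.Perm (Fin n)) (b : ℕ) (j : Fin b) : Fin d → ℝ :=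
  A (n / b) fun i => x (σ (blockIndex n b j i))

/-- The rectangular hull confidence region computed from the data `x`, the value `u` of the
uniform random variable and the permutation `σ` that splits the data. -/
def confRegion {𝒳 : Type*} {d n : ℕ} (α : ℝ) (A : (m : ℕ) → (Fin m → 𝒳) → Fin d → ℝ)
    (x : Fin n → 𝒳) (u : ℝ) (σ : Equiv.Perm (Fin n)) : Set (Fin d → ℝ) :=
  rectHull (batchEstimator A x σ (Bstar α d u))

/-- The discrete σ-algebra on permutations of a finite set. -/
instance permMeasurableSpace (n : ℕ) : MeasurableSpace (Equiv.Perm (Fin n)) := ⊤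

end OrthantHulC

end

noncomputable section

namespace OrthantHulC

/-! ### Sums over tuples weighted by a product of masses -/

/-! The region misses `θ₀` exactly when, in some coordinate, all batch errors have the same strict
sign. Miscoverage is therefore the mean of an indicator `signMissInd` of `B` independent sign
vectors, and only the law of one sign vector matters.

This indicator can only grow when a zero entry of one argument is replaced by a sign, so an
elementary operation never decreases the mean (`tupleSum_mono_mass`, `MCHLE.sum_le`). Hence the
error law may be replaced by an MCH law with bias arbitrarily close to `δ`, that is, by a law `p` on
`{-1, 1}^d` with masses at least `2^{-d} - δ / 2^{d-1}`.

Compare `p` with the uniform law `u` on the group `{-1, 1}^d`. The indicator is invariant under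
multiplying all arguments by one group element, so averaging all arguments but one over `u` leaves a
constant, and the first order term in `p - u` vanishes. Each of the `B(B-1)/2` pairs of factors then
costs at most a quadratic form in `p - u` (`tupleSum_le_uniform_add`). Opposite vectors in two slots
rule out a common sign, and this vanishing bounds the form by `2^d δ²` (`sum_sum_perturbation_le`).

Under `u` the miscoverage is `1 - (1 - 2^{1-B})^d = U(B, 0; d)`, and `tau` mixes the values at two
consecutive `B` to exactly `α`. Disjoint blocks of an i.i.d. sample give i.i.d. estimators for every
fixed permutation (`pi_map_batchEstimator`), so independence of the data from the randomization
allows conditioning on it. -/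

/-- The integral of `g` against the `B`-fold product of the mass function `m`. -/
def tupleSum {S : Type*} [Fintype S] (B : ℕ) (m : S → ℝ) (g : (Fin B → S) → ℝ) : ℝ :=
  ∑ s : Fin B → S, (∏ k, m (s k)) * g s

section tupleSum

variable {S : Type*} [Fintype S]

lemma tupleSum_succ (B : ℕ) (m : S → ℝ) (g : (Fin (B + 1) → S) → ℝ) :
    tupleSum (B + 1) m g = ∑ a, m a * tupleSum B m (fun s => g (Fin.cons a s)) := by
  unfold tupleSum
  rw [← (Fin.consEquiv fun _ : Fin (B + 1) => S).sum_comp, Fintype.sum_prod_type]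
  simp [Fin.consEquiv, Fin.prod_univ_succ, Finset.mul_sum, mul_assoc]

lemma tupleSum_sum_mul (B : ℕ) (m c : S → ℝ) (g : S → (Fin B → S) → ℝ) :
    tupleSum B m (fun s => ∑ a, c a * g a s) = ∑ a, c a * tupleSum B m (g a) := by
  simp only [tupleSum, Finset.mul_sum]
  rw [Finset.sum_comm]
  exact Finset.sum_congr rfl fun a _ => Finset.sum_congr rfl fun s _ => by ring

lemma tupleSum_const (B : ℕ) (m : S → ℝ) (hm : ∑ a, m a = 1) (c : ℝ) :
    tupleSum B m (fun _ => c) = c := by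
  induction B with
  | zero => simp [tupleSum]
  | succ B ih => simp [tupleSum_succ, ih, ← Finset.sum_mul, hm]

lemma tupleSum_le_tupleSum (B : ℕ) (m : S → ℝ) (hm : ∀ a, 0 ≤ m a) {g h : (Fin B → S) → ℝ}
    (hgh : ∀ s, g s ≤ h s) : tupleSum B m g ≤ tupleSum B m h :=
  Finset.sum_le_sum fun s _ =>
    mul_le_mul_of_nonneg_left (hgh s) (Finset.prod_nonneg fun k _ => hm (s k))

/-- If `m` is dominated by `m'` on functions monotone for `r`, then so are the products on functions
monotone in each coordinate. -/
lemma tupleSum_mono_mass (r : S → S → Prop) (m m' : S → ℝ) (hm : ∀ a, 0 ≤ m a)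
    (hm' : ∀ a, 0 ≤ m' a)
    (hdom : ∀ G : S → ℝ, (∀ a b, r a b → G a ≤ G b) → ∑ a, m a * G a ≤ ∑ a, m' a * G a)
    (B : ℕ) (g : (Fin B → S) → ℝ)
    (hg : ∀ s k a b, r a b → g (Function.update s k a) ≤ g (Function.update s k b)) :
    tupleSum B m g ≤ tupleSum B m' g := by
  induction B with
  | zero => simp [tupleSum]
  | succ B ih =>
    rw [tupleSum_succ, tupleSum_succ]
    -- The tail factors are exchanged first. Integrating them out then leaves a function of the head
    -- that is still monotone for `r`, to which `hdom` applies.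
    calc ∑ a, m a * tupleSum B m (fun s => g (Fin.cons a s))
        ≤ ∑ a, m a * tupleSum B m' (fun s => g (Fin.cons a s)) := by
          refine Finset.sum_le_sum fun a _ => mul_le_mul_of_nonneg_left (ih _ ?_) (hm a)
          intro s k b c hbc
          simpa [Fin.cons_update] using hg (Fin.cons a s) k.succ b c hbc
      _ ≤ _ := by
          refine hdom _ fun a b hab => tupleSum_le_tupleSum B m' hm' fun s => ?_
          simpa using hg (Fin.cons a s) 0 a b hab

/-- Telescoping: `p` is exchanged for `u` one factor at a time, and each exchange costs at most `Q`
whatever the other arguments are. -/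
lemma tupleSum_le_add_mul (p u : S → ℝ) (hp : ∀ a, 0 ≤ p a) (hu : ∀ a, 0 ≤ u a)
    (hp1 : ∑ a, p a = 1) (hu1 : ∑ a, u a = 1) (Q : ℝ) (B : ℕ) (h : (Fin B → S) → ℝ)
    (hh : ∀ s k, ∑ b, (p b - u b) * h (Function.update s k b) ≤ Q) :
    tupleSum B p h ≤ tupleSum B u h + B * Q := by
  induction B with
  | zero => simp [tupleSum]
  | succ B ih =>
    have h1 : tupleSum (B + 1) p h
        ≤ ∑ a, p a * (tupleSum B u (fun s => h (Fin.cons a s)) + B * Q) := by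
      rw [tupleSum_succ]
      refine Finset.sum_le_sum fun a _ => mul_le_mul_of_nonneg_left (ih _ fun s k => ?_) (hp a)
      simpa [Fin.cons_update] using hh (Fin.cons a s) k.succ
    have h2 : ∑ a, (p a - u a) * tupleSum B u (fun s => h (Fin.cons a s)) ≤ Q := by
      rw [← tupleSum_sum_mul]
      refine le_of_le_of_eq (tupleSum_le_tupleSum B u hu (h := fun _ => Q) fun s => ?_)
        (tupleSum_const B u hu1 Q)
      rcases isEmpty_or_nonempty S with hS | ⟨⟨a⟩⟩
      · simp at hu1
      · simpa using hh (Fin.cons a s) 0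
    simp only [mul_add, Finset.sum_add_distrib, ← Finset.sum_mul, hp1] at h1
    simp only [sub_mul, Finset.sum_sub_distrib, ← tupleSum_succ] at h2
    push_cast
    linarith

/-- A second order comparison of the products of a mass function `p` and of the uniform mass
function on a finite group, for functions invariant under the diagonal action. -/
lemma tupleSum_le_uniform_add [Group S] (p : S → ℝ) (hp : ∀ a, 0 ≤ p a)
    (hp1 : ∑ a, p a = 1) (Q : ℝ) (B : ℕ) (g : (Fin B → S) → ℝ)
    (hinv : ∀ (t : S) s, g (fun k => t * s k) = g s)
    (hpair : ∀ s k l, k ≠ l → ∑ b, (p b - (Fintype.card S : ℝ)⁻¹) *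
      ∑ a, (p a - (Fintype.card S : ℝ)⁻¹) * g (Function.update (Function.update s k a) l b) ≤ Q) :
    tupleSum B p g ≤ tupleSum B (fun _ => (Fintype.card S : ℝ)⁻¹) g + B * (B - 1) / 2 * Q := by
  set u : S → ℝ := fun _ => (Fintype.card S : ℝ)⁻¹ with hu
  have hu0 : ∀ a, 0 ≤ u a := fun a => by positivity
  have hu1 : ∑ a, u a = 1 := by simp [hu]
  induction B with
  | zero => simp [tupleSum]
  | succ B ih =>
    have hinvcons : ∀ (t a : S) s, g (Fin.cons (t * a) fun k => t * s k) = g (Fin.cons a s) := by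
      intro t a s
      rw [← hinv t (Fin.cons a s)]
      congr 1
      ext k
      refine Fin.cases ?_ (fun k => ?_) k <;> simp
    -- Averaging the head over `u` preserves diagonal invariance, so the induction hypothesis
    -- controls the pairs inside the tail.
    have h1 := ih (fun s => ∑ a, u a * g (Fin.cons a s)) (by
        intro t s
        refine (Equiv.sum_comp (Equiv.mulLeft t) _).symm.trans ?_
        simp [hinvcons, hu]) (by
        intro s k l hkl
        have := fun a => hpair (Fin.cons a s) k.succ l.succ (by simpa using hkl)
        simp only [← Fin.cons_update] at this
        calc _ = ∑ c, u c * ∑ b, (p b - (Fintype.card S : ℝ)⁻¹) *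
                  ∑ a, (p a - (Fintype.card S : ℝ)⁻¹) *
                    g (Fin.cons c (Function.update (Function.update s k a) l b)) := by
                simp only [Finset.mul_sum]
                symm
                rw [Finset.sum_comm]
                refine Finset.sum_congr rfl fun b _ => ?_
                rw [Finset.sum_comm]
                exact Finset.sum_congr rfl fun a _ => Finset.sum_congr rfl fun c _ => by ring
          _ ≤ ∑ c, u c * Q := Finset.sum_le_sum fun c _ =>
                mul_le_mul_of_nonneg_left (this c) (hu0 c)
          _ = Q := by rw [← Finset.sum_mul, hu1, one_mul])
    -- The `B` pairs formed by the head and one tail factor; `B(B-1)/2 + B = (B+1)B/2`.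
    have h2 := tupleSum_le_add_mul p u hp hu0 hp1 hu1 Q B
      (fun s => ∑ a, (p a - u a) * g (Fin.cons a s)) (by
        intro s k
        rcases isEmpty_or_nonempty S with hS | ⟨⟨c⟩⟩
        · simp at hu1
        · simpa [← Fin.cons_update] using hpair (Fin.cons c s) 0 k.succ (Fin.succ_ne_zero k).symm)
    -- The first order term: by invariance the uniform average of the tail does not depend on the
    -- head `a`, and `p - u` has total mass zero.
    have h3 : tupleSum B u (fun s => ∑ a, (p a - u a) * g (Fin.cons a s)) = 0 := by
      have hc : ∀ a, tupleSum B u (fun s => g (Fin.cons a s))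
          = tupleSum B u (fun s => g (Fin.cons 1 s)) := by
        intro a
        unfold tupleSum
        refine (Equiv.sum_comp (Equiv.piCongrRight fun _ => Equiv.mulLeft a) _).symm.trans ?_
        refine Finset.sum_congr rfl fun s _ => ?_
        have := hinvcons a 1 s
        rw [mul_one] at this
        simp only [hu]
        exact congrArg _ this
      rw [tupleSum_sum_mul]
      simp only [hc, ← Finset.sum_mul, Finset.sum_sub_distrib, hp1, hu1]
      simp
    rw [h3, tupleSum_sum_mul] at h2
    rw [tupleSum_sum_mul, tupleSum_sum_mul, ← tupleSum_succ] at h1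
    simp only [sub_mul, Finset.sum_sub_distrib] at h2
    rw [← tupleSum_succ] at h2
    push_cast
    linarith

end tupleSum

/-! ### A quadratic form inequality on a finite set with an involution -/

/-- A quadratic form bound for perturbations of the uniform mass function on a group of order
`2` or at least `4`. -/
lemma sum_sum_perturbation_le {V : Type*} [Fintype V] [Nonempty V] (n : V → V)
    (hn : Function.Involutive n)
    (hN : Fintype.card V = 2 ∨ 4 ≤ Fintype.card V) (e : V → ℝ) (he : ∑ a, e a = 0) (y : ℝ)
    (hey : ∀ a, -y ≤ e a) (G : V → V → ℝ) (hG0 : ∀ a b, 0 ≤ G a b) (hG1 : ∀ a b, G a b ≤ 1)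
    (hGn : ∀ b, G (n b) b = 0) :
    ∑ b, e b * ∑ a, e a * G a b ≤ (Fintype.card V : ℝ) ^ 3 / 4 * y ^ 2 := by
  classical
  set N : ℝ := (Fintype.card V : ℝ) with hNdef
  obtain ⟨a₀, -, ha₀⟩ : ∃ a ∈ Finset.univ, 0 ≤ e a := by
    by_contra! h
    have := Finset.sum_lt_sum_of_nonempty Finset.univ_nonempty h
    simp [he] at this
  set w : V → ℝ := fun a => max (-e a) 0 with hw
  set v : V → ℝ := fun a => max (e a) 0 with hv
  have hev : ∀ a, e a = v a - w a := fun a => by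
    simp only [hv, hw]; rcases le_total 0 (e a) with h | h <;> simp [h]
  have hw0 : ∀ a, 0 ≤ w a := fun a => le_max_right _ _
  have hv0 : ∀ a, 0 ≤ v a := fun a => le_max_right _ _
  have hy : 0 ≤ y := by
    by_contra! h
    have := Finset.sum_lt_sum_of_nonempty (Finset.univ_nonempty (α := V))
      (fun a _ => (by linarith [hey a] : (0 : ℝ) < e a))
    simp [he] at this
  have hwy : ∀ a, w a ≤ y := fun a => max_le (by linarith [hey a]) hy
  set S := ∑ a, w a with hS
  have hvS : ∑ a, v a = S := by
    have : ∑ a, v a - ∑ a, w a = 0 := by rw [← Finset.sum_sub_distrib, ← he]; simp [hev]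
    linarith
  have hS0 : 0 ≤ S := Finset.sum_nonneg fun a _ => hw0 a
  -- Some `a₀` has no negative part, which gives `N - 1` in place of `N`.
  have hSN : S ≤ (N - 1) * y := by
    have : S ≤ ∑ a, if a = a₀ then 0 else y := Finset.sum_le_sum fun a _ => by
      split_ifs with h
      · subst h; simp [hw, ha₀]
      · exact hwy a
    refine this.trans (le_of_eq ?_)
    have h2 : ∀ a, (if a = a₀ then 0 else y) = y - if a = a₀ then y else 0 := fun a => by
      split_ifs <;> simp
    simp [h2, Finset.sum_sub_distrib, hNdef]
    ring
  -- Sum of `(y - w b) * (y - w (n b)) ≥ 0` over `b`.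
  have hP : 2 * S * y - N * y ^ 2 ≤ ∑ b, w b * w (n b) := by
    have h1 : ∑ b, w (n b) = S := (Equiv.sum_comp hn.toPerm w)
    have h2 : ∑ b, (w b * y + w (n b) * y - y ^ 2) ≤ ∑ b, w b * w (n b) :=
      Finset.sum_le_sum fun b _ => by nlinarith [hwy b, hwy (n b)]
    rw [Finset.sum_sub_distrib, Finset.sum_add_distrib, ← Finset.sum_mul, ← Finset.sum_mul, h1]
      at h2
    simp at h2
    linarith
  -- Only products of entries of equal sign contribute positively, and `G` vanishes on the pairs `(n
  -- b, b)`.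
  have hmain : ∑ b, e b * ∑ a, e a * G a b ≤ 2 * S ^ 2 - ∑ b, w b * w (n b) := by
    have h1 : ∀ b, e b * ∑ a, e a * G a b
        ≤ ∑ a, (v b * v a + w b * w a - if a = n b then w b * w a else 0) := by
      intro b
      rw [Finset.mul_sum]
      refine Finset.sum_le_sum fun a _ => ?_
      have hb := hev b
      have ha := hev a
      split_ifs with h
      · subst h; rw [hGn]; simp; exact mul_nonneg (hv0 _) (hv0 _)
      · rw [hb, ha]
        have := hG0 a b
        have := hG1 a b
        have h3 : 0 ≤ (v b * v a + w b * w a) * (1 - G a b) := mul_nonneg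
          (add_nonneg (mul_nonneg (hv0 _) (hv0 _)) (mul_nonneg (hw0 _) (hw0 _))) (by linarith)
        have h4 : 0 ≤ (v b * w a + w b * v a) * G a b := mul_nonneg
          (add_nonneg (mul_nonneg (hv0 _) (hw0 _)) (mul_nonneg (hw0 _) (hv0 _))) (by linarith)
        nlinarith
    refine (Finset.sum_le_sum fun b _ => h1 b).trans (le_of_eq ?_)
    simp only [Finset.sum_sub_distrib, Finset.sum_add_distrib, ← Finset.mul_sum,
      ← Finset.sum_mul, hvS, ← hS]
    simp
    ring
  have hpoly : 2 * S ^ 2 - 2 * S * y ≤ 2 * ((N - 1) * y) * ((N - 2) * y) := by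
    have hN2 : 2 ≤ N := by
      have : 2 ≤ Fintype.card V := by omega
      rw [hNdef]
      exact_mod_cast this
    have h5 : 0 ≤ (N - 2) * y := mul_nonneg (by linarith) hy
    rcases le_total S y with h | h <;> nlinarith
  -- The gap between the target and the bound obtained is `N³/4 - 2(N-1)(N-2) - N = (N-2)²(N-4)/4`.
  -- It is negative at `N = 3`, hence the condition on the cardinality.
  have hcube : 0 ≤ (N - 2) ^ 2 * (N - 4) := by
    rcases hN with h | h
    · simp [hNdef, h]
    · have : (4 : ℝ) ≤ N := by rw [hNdef]; exact_mod_cast h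
      exact mul_nonneg (sq_nonneg _) (by linarith)
  nlinarith [mul_nonneg hcube (sq_nonneg y)]

/-! ### The miscoverage of the rectangular hull in terms of signs -/

/-- All the sign vectors have a common nonzero entry in some coordinate. -/
def SignMiss {d B : ℕ} (s : Fin B → SignVec d) : Prop :=
  ∃ j, (∀ k, s k j = 1) ∨ (∀ k, s k j = -1)

open Classical in
/-- The indicator function of `SignMiss`. -/
def signMissInd {d B : ℕ} (s : Fin B → SignVec d) : ℝ := if SignMiss s then 1 else 0

lemma signMissInd_nonneg {d B : ℕ} (s : Fin B → SignVec d) : 0 ≤ signMissInd s := by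
  unfold signMissInd; split_ifs <;> norm_num

lemma signMissInd_le_one {d B : ℕ} (s : Fin B → SignVec d) : signMissInd s ≤ 1 := by
  unfold signMissInd; split_ifs <;> norm_num

lemma signMissInd_of_signMiss {d B : ℕ} {s : Fin B → SignVec d} (h : SignMiss s) :
    signMissInd s = 1 := if_pos h

lemma signMissInd_of_not_signMiss {d B : ℕ} {s : Fin B → SignVec d} (h : ¬ SignMiss s) :
    signMissInd s = 0 := if_neg h

/-- A common sign is a nonzero entry, and passing to a larger vector in the sign ordering keeps
nonzero entries. -/
lemma signMissInd_update_le {d B : ℕ} (s : Fin B → SignVec d) (k : Fin B) (a b : SignVec d)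
    (hab : SignLE a b) :
    signMissInd (Function.update s k a) ≤ signMissInd (Function.update s k b) := by
  have : SignMiss (Function.update s k a) → SignMiss (Function.update s k b) := by
    rintro ⟨j, h⟩
    refine ⟨j, ?_⟩
    refine h.imp (fun h l => ?_) (fun h l => ?_) <;>
    · have hl := h l
      by_cases hlk : l = k
      · subst hlk
        simp only [Function.update_self] at hl ⊢
        rw [← hab.1 j (by rw [hl]; decide), hl]
      · simpa [hlk] using hl
  by_cases h : SignMiss (Function.update s k a)
  · rw [signMissInd_of_signMiss h, signMissInd_of_signMiss (this h)]
  · rw [signMissInd_of_not_signMiss h]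
    exact signMissInd_nonneg _

/-- The sign vector without zero entries given by a tuple of units. -/
def unitSigns {d : ℕ} (v : Fin d → ℤˣ) : SignVec d := fun j => SignType.sign (v j : ℤ)

lemma sign_unit_eq_one {u : ℤˣ} : SignType.sign (u : ℤ) = 1 ↔ u = 1 := by
  rcases Int.units_eq_one_or u with rfl | rfl <;> decide

lemma sign_unit_eq_neg_one {u : ℤˣ} : SignType.sign (u : ℤ) = -1 ↔ u = -1 := by
  rcases Int.units_eq_one_or u with rfl | rfl <;> decide

lemma unitSigns_injective {d : ℕ} : Function.Injective (unitSigns (d := d)) := by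
  intro v w h
  funext j
  have := congrFun h j
  rcases Int.units_eq_one_or (w j) with hw | hw
  · rw [hw]; exact sign_unit_eq_one.1 (this.trans (sign_unit_eq_one.2 hw))
  · rw [hw]; exact sign_unit_eq_neg_one.1 (this.trans (sign_unit_eq_neg_one.2 hw))

lemma unitSigns_mem_fullSigns {d : ℕ} (v : Fin d → ℤˣ) : unitSigns v ∈ fullSigns d := by
  intro j
  simp [unitSigns]

lemma range_unitSigns {d : ℕ} : Set.range (unitSigns (d := d)) = fullSigns d := by
  refine Set.Subset.antisymm (Set.range_subset_iff.2 unitSigns_mem_fullSigns) fun η hη => ?_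
  refine ⟨fun j => if η j = 1 then 1 else -1, funext fun j => ?_⟩
  have := hη j
  simp only [unitSigns]
  rcases h : η j with _ | _ | _
  · exact absurd h this
  · decide
  · decide

lemma signMiss_unitSigns {d B : ℕ} (s : Fin B → Fin d → ℤˣ) :
    SignMiss (fun k => unitSigns (s k)) ↔ ∃ j, (∀ k, s k j = 1) ∨ (∀ k, s k j = -1) := by
  simp only [SignMiss, unitSigns, sign_unit_eq_one, sign_unit_eq_neg_one]

/-- Flipping a coordinate in all vectors only swaps "all positive" with "all negative" there. -/
lemma signMissInd_unitSigns_mul {d B : ℕ} (t : Fin d → ℤˣ) (s : Fin B → Fin d → ℤˣ) :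
    signMissInd (fun k => unitSigns (t * s k)) = signMissInd (fun k => unitSigns (s k)) := by
  have : SignMiss (fun k => unitSigns (t * s k)) ↔ SignMiss (fun k => unitSigns (s k)) := by
    rw [signMiss_unitSigns, signMiss_unitSigns]
    refine exists_congr fun j => ?_
    rcases Int.units_eq_one_or (t j) with h | h
    · simp [h]
    · simp [h, neg_eq_iff_eq_neg, or_comm]
  by_cases h : SignMiss (fun k => unitSigns (s k))
  · rw [signMissInd_of_signMiss h, signMissInd_of_signMiss (this.2 h)]
  · rw [signMissInd_of_not_signMiss h, signMissInd_of_not_signMiss (mt this.1 h)]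

lemma sum_units_not_const (B : ℕ) (hB : 1 ≤ B) :
    ∑ w : Fin B → ℤˣ, (if (∀ k, w k = 1) ∨ (∀ k, w k = -1) then (0 : ℝ) else 1) = 2 ^ B - 2 := by
  have h : ∀ w : Fin B → ℤˣ, (if (∀ k, w k = 1) ∨ (∀ k, w k = -1) then (0 : ℝ) else 1)
      = 1 - (if w = (fun _ => 1) then 1 else 0) - (if w = (fun _ => -1) then 1 else 0) := by
    intro w
    have : Nonempty (Fin B) := ⟨⟨0, hB⟩⟩
    have h1 : w = (fun _ => 1) ↔ ∀ k, w k = 1 := funext_iff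
    have h2 : w = (fun _ => -1) ↔ ∀ k, w k = -1 := funext_iff
    have h3 : ¬ ((∀ k, w k = 1) ∧ (∀ k, w k = -1)) := by
      rintro ⟨h, h'⟩
      have := (h ⟨0, hB⟩).symm.trans (h' ⟨0, hB⟩)
      exact absurd this (by decide)
    rw [if_congr h1 rfl rfl, if_congr h2 rfl rfl]
    by_cases h4 : ∀ k, w k = 1 <;> by_cases h5 : ∀ k, w k = -1
    · exact absurd ⟨h4, h5⟩ h3
    all_goals simp [h4, h5]
  simp_rw [h]
  simp [Finset.sum_sub_distrib]
  ring

/-- Under the uniform law the `d` coordinates are independent, and each is nonconstant over the `B`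
draws with probability `1 - 2 · 2^{-B}`. -/
lemma tupleSum_uniform_signMissInd {d B : ℕ} (hB : 1 ≤ B) :
    tupleSum B (fun _ : Fin d → ℤˣ => (Fintype.card (Fin d → ℤˣ) : ℝ)⁻¹)
      (fun s => signMissInd fun k => unitSigns (s k)) = 1 - (1 - 2 * (1 / 2) ^ B) ^ d := by
  have h1 : ∀ s : Fin B → Fin d → ℤˣ, signMissInd (fun k => unitSigns (s k))
      = 1 - ∏ j, if (∀ k, s k j = 1) ∨ (∀ k, s k j = -1) then (0 : ℝ) else 1 := by
    intro s
    by_cases h : SignMiss fun k => unitSigns (s k)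
    · rw [signMissInd_of_signMiss h]
      obtain ⟨j, hj⟩ := (signMiss_unitSigns s).1 h
      rw [Finset.prod_eq_zero (Finset.mem_univ j), sub_zero]
      exact if_pos hj
    · rw [signMissInd_of_not_signMiss h]
      rw [signMiss_unitSigns] at h
      push Not at h
      rw [Finset.prod_eq_one, sub_self]
      intro j _
      rw [if_neg]
      push Not
      exact h j
  have h2 : ∑ s : Fin B → Fin d → ℤˣ,
      ∏ j, (if (∀ k, s k j = 1) ∨ (∀ k, s k j = -1) then (0 : ℝ) else 1) = (2 ^ B - 2) ^ d := by
    rw [← sum_units_not_const B hB, ← Fin.prod_const, Finset.prod_univ_sum,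
      Fintype.piFinset_univ]
    exact (Equiv.sum_comp (Equiv.piComm fun (_ : Fin B) (_ : Fin d) => ℤˣ) fun t =>
      ∏ j, (if (∀ k, t j k = 1) ∨ (∀ k, t j k = -1) then (0 : ℝ) else 1))
  unfold tupleSum
  simp_rw [h1]
  rw [← Finset.mul_sum, Finset.sum_sub_distrib, h2]
  simp only [Finset.prod_const, Finset.card_univ, Fintype.card_fin, Fintype.card_pi,
    Fintype.card_units_int, Finset.sum_const, nsmul_eq_mul, mul_one, Nat.cast_pow, Nat.cast_ofNat]
  have h3 : (1 - 2 * (1 / 2) ^ B : ℝ) = (2 ^ B - 2) / 2 ^ B := by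
    rw [one_div, inv_pow]
    field_simp
  rw [h3, div_pow, mul_sub, inv_pow, ← pow_mul, ← pow_mul, mul_comm d B,
    inv_mul_cancel₀ (by positivity)]
  ring

/-- Moves the sum to the group `Fin d → ℤˣ`, where the invariance argument is available. -/
lemma tupleSum_unitSigns {d B : ℕ} (m : SignVec d → ℝ) (hm : ∀ η ∉ fullSigns d, m η = 0)
    (g : (Fin B → SignVec d) → ℝ) :
    tupleSum B m g = tupleSum B (fun v => m (unitSigns v)) (fun s => g fun k => unitSigns (s k)) := by
  symm
  refine Fintype.sum_of_injective (fun s k => unitSigns (s k)) ?_ _ _ ?_ fun _ => rfl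
  · intro s t h
    exact funext fun k => unitSigns_injective (congrFun h k)
  · intro s hs
    have : ∃ k, s k ∉ fullSigns d := by
      by_contra! h
      simp only [← range_unitSigns, Set.mem_range] at h
      choose f hf using h
      exact hs ⟨f, funext hf⟩
    obtain ⟨k, hk⟩ := this
    rw [Finset.prod_eq_zero (Finset.mem_univ k) (hm _ hk), zero_mul]

/-- The miscoverage bound for a law on `{-1, 1}^d` all of whose masses are at least
`2^{-d} - δ / 2^{d-1}`. -/
lemma tupleSum_signMissInd_le {d B : ℕ} (hd : 1 ≤ d) (hB : 1 ≤ B) (m : SignVec d → ℝ)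
    (hm0 : ∀ η, 0 ≤ m η) (hm : ∀ η ∉ fullSigns d, m η = 0) (hm1 : ∑ η, m η = 1) (δ : ℝ)
    (hδ : ∀ η ∈ fullSigns d, 1 / 2 ^ d - δ / 2 ^ (d - 1) ≤ m η) :
    tupleSum B m signMissInd
      ≤ 1 - (1 - 2 * (1 / 2) ^ B) ^ d + 2 ^ (d - 1) * (B : ℝ) * ((B : ℝ) - 1) * δ ^ 2 := by
  have hcard : Fintype.card (Fin d → ℤˣ) = 2 ^ d := by simp
  have hp1 : ∑ v : Fin d → ℤˣ, m (unitSigns v) = 1 := by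
    rw [← hm1]
    refine Fintype.sum_of_injective _ unitSigns_injective _ _ (fun η hη => hm η ?_) fun _ => rfl
    rwa [range_unitSigns] at hη
  rw [tupleSum_unitSigns m hm, ← tupleSum_uniform_signMissInd hB]
  refine (tupleSum_le_uniform_add (fun v => m (unitSigns v)) (fun v => hm0 _) hp1
    (2 ^ d * δ ^ 2) B (fun s => signMissInd fun k => unitSigns (s k))
    (fun t s => signMissInd_unitSigns_mul t s) fun s k l hkl => ?_).trans (le_of_eq ?_)
  · refine (sum_sum_perturbation_le (fun v => -v) neg_involutive ?_ _ ?_ (δ / 2 ^ (d - 1)) ?_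
      (fun a b => signMissInd fun i =>
        unitSigns (Function.update (Function.update s k a) l b i))
      (fun _ _ => signMissInd_nonneg _) (fun _ _ => signMissInd_le_one _) ?_).trans (le_of_eq ?_)
    · rw [hcard]
      rcases hd.eq_or_lt with rfl | hd
      · simp
      · exact Or.inr (le_trans (by norm_num) (Nat.pow_le_pow_right (n := 2) (by norm_num) hd))
    · rw [Finset.sum_sub_distrib, hp1]
      simp
    · intro v
      have := hδ _ (unitSigns_mem_fullSigns v)
      rw [hcard]
      push_cast
      rw [one_div] at this
      linarith
    · intro b
      -- Slots `k` and `l` hold opposite vectors, so no coordinate has a common sign.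
      refine signMissInd_of_not_signMiss ?_
      rw [signMiss_unitSigns]
      rintro ⟨j, h | h⟩
      · have h1 := h k
        have h2 := h l
        simp [hkl] at h1 h2
        rw [h2] at h1
        exact absurd h1 (show ¬ (-1 : ℤˣ) = 1 by decide)
      · have h1 := h k
        have h2 := h l
        simp [hkl] at h1 h2
        rw [h2] at h1
        exact absurd h1 (show ¬ (-1 : ℤˣ) = 1 by decide)
    · rw [hcard]
      obtain ⟨e, rfl⟩ : ∃ e, d = e + 1 := ⟨d - 1, by omega⟩
      push_cast
      field_simp
      ring
  · obtain ⟨e, rfl⟩ : ∃ e, d = e + 1 := ⟨d - 1, by omega⟩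
    rw [Nat.add_sub_cancel]
    ring

/-! ### The number of batches and the randomization threshold -/

/-- Binomial expansion of the right side; at `δ = 0` each odd bracket collapses to `2^j (2^{-j})^B`.
-/
lemma upperU_zero (B d : ℕ) : upperU B 0 d = 1 - (1 - 2 * (1 / 2) ^ B) ^ d := by
  have h1 : (1 - 2 * (1 / 2) ^ B : ℝ) ^ d
      = 1 + ∑ j ∈ Finset.Icc 1 d, (d.choose j : ℝ) * (-1) ^ j * 2 ^ j * (1 / 2 ^ j) ^ B := by
    rw [sub_eq_neg_add, add_pow, Finset.range_eq_Ico,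
      Finset.sum_eq_sum_Ico_succ_bot (Nat.succ_pos d)]
    congr 1
    · simp
    · refine Finset.sum_congr (by ext; simp) fun j _ => ?_
      rw [neg_pow, mul_pow, ← pow_mul, one_div_pow, one_div_pow, ← pow_mul, mul_comm B j]
      ring
  rw [h1, ← Finset.sum_filter_add_sum_filter_not (Finset.Icc 1 d) (fun j => Odd j)]
  simp only [upperU, Nat.not_odd_iff_even]
  have h2 : ∀ j ∈ (Finset.Icc 1 d).filter (fun j => Odd j),
      (d.choose j : ℝ) * (-1) ^ j * 2 ^ j * (1 / 2 ^ j) ^ B = -((d.choose j : ℝ) *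
      (((2 : ℝ) ^ j - 1) * (1 / 2 ^ j - 0 / 2 ^ (j - 1)) ^ B
        + (1 / 2 ^ j + ((2 : ℝ) ^ j - 1) * (0 / 2 ^ (j - 1))) ^ B)) := by
    intro j hj
    rw [(Finset.mem_filter.1 hj).2.neg_one_pow]
    simp
    ring
  have h3 : ∀ j ∈ (Finset.Icc 1 d).filter (fun j => Even j),
      (d.choose j : ℝ) * (-1) ^ j * 2 ^ j * (1 / 2 ^ j) ^ B
        = (d.choose j : ℝ) * 2 ^ j * (1 / 2 ^ j) ^ B := by
    intro j hj
    rw [(Finset.mem_filter.1 hj).2.neg_one_pow]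
    ring
  rw [Finset.sum_congr rfl h2, Finset.sum_congr rfl h3, Finset.sum_neg_distrib]
  ring

/-- With `c = (1 - α)^{1/d}`, the inequality `U(B, 0; d) ≤ α` amounts to `2^{1-B} ≤ 1 - c`, and the
ceiling is the least such `B`. As `B ≥ 2`, even `B - 1` batches are a nonempty family. -/
lemma two_le_numBatches_and_upperU {α : ℝ} (hα0 : 0 < α) (hα1 : α < 1) {d : ℕ} (hd : 1 ≤ d) :
    2 ≤ numBatches α d ∧ upperU (numBatches α d) 0 d ≤ α ∧ α < upperU (numBatches α d - 1) 0 d := by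
  set c : ℝ := (1 - α) ^ (1 / (d : ℝ)) with hc
  have hd0 : (d : ℝ) ≠ 0 := by positivity
  have hcd : c ^ d = 1 - α := by
    rw [hc, ← Real.rpow_natCast, ← Real.rpow_mul (by linarith), one_div_mul_cancel hd0,
      Real.rpow_one]
  have hc0 : 0 < c := Real.rpow_pos_of_pos (by linarith) _
  have hc1 : c < 1 := Real.rpow_lt_one (by linarith) (by linarith) (by positivity)
  have hL : Real.logb 2 (1 - c) < 0 := Real.logb_neg (by norm_num) (by linarith) (by linarith)
  set B := numBatches α d with hB
  have hle : 1 - Real.logb 2 (1 - c) ≤ B := Nat.le_ceil _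
  have hB2 : 2 ≤ B := by
    have : (1 : ℝ) < B := by linarith
    have : 1 < B := by exact_mod_cast this
    omega
  have hlt : ((B - 1 : ℕ) : ℝ) < 1 - Real.logb 2 (1 - c) := by
    refine Nat.lt_ceil.1 ?_
    change B - 1 < B
    omega
  have key : ∀ k : ℕ, 2 * (1 / 2 : ℝ) ^ k = (2 : ℝ) ^ (1 - (k : ℝ)) := by
    intro k
    rw [Real.rpow_sub (by norm_num), Real.rpow_one, Real.rpow_natCast, one_div, inv_pow]
    rfl
  have hlog : (2 : ℝ) ^ Real.logb 2 (1 - c) = 1 - c :=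
    Real.rpow_logb (by norm_num) (by norm_num) (by linarith)
  refine ⟨hB2, ?_, ?_⟩
  · have h1 : 2 * (1 / 2 : ℝ) ^ B ≤ 1 - c := by
      rw [key, ← hlog]
      exact Real.rpow_le_rpow_of_exponent_le (by norm_num) (by linarith)
    rw [upperU_zero]
    have := pow_le_pow_left₀ hc0.le (by linarith : c ≤ 1 - 2 * (1 / 2 : ℝ) ^ B) d
    linarith
  · have h1 : 1 - c < 2 * (1 / 2 : ℝ) ^ (B - 1) := by
      rw [key, ← hlog]
      exact Real.rpow_lt_rpow_of_exponent_lt (by norm_num) (by linarith)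
    have h2 : 2 * (1 / 2 : ℝ) ^ (B - 1) ≤ 1 := by
      have : (1 / 2 : ℝ) ^ (B - 1) ≤ (1 / 2 : ℝ) ^ 1 :=
        pow_le_pow_of_le_one (by norm_num) (by norm_num) (by omega)
      linarith
    rw [upperU_zero]
    have := pow_lt_pow_left₀ (by linarith : 1 - 2 * (1 / 2 : ℝ) ^ (B - 1) < c) (by linarith)
      (by omega : d ≠ 0)
    linarith

lemma tau_mem_Icc {α : ℝ} (hα0 : 0 < α) (hα1 : α < 1) {d : ℕ} (hd : 1 ≤ d) :
    tau α d ∈ Set.Icc 0 1 ∧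
    tau α d * upperU (numBatches α d - 1) 0 d + (1 - tau α d) * upperU (numBatches α d) 0 d = α := by
  obtain ⟨-, h1, h2⟩ := two_le_numBatches_and_upperU hα0 hα1 hd
  have h3 : 0 < upperU (numBatches α d - 1) 0 d - upperU (numBatches α d) 0 d := by linarith
  refine ⟨⟨div_nonneg (by linarith) h3.le, (div_le_one h3).2 (by linarith)⟩, ?_⟩
  have : tau α d * (upperU (numBatches α d - 1) 0 d - upperU (numBatches α d) 0 d)
      = α - upperU (numBatches α d) 0 d := div_mul_cancel₀ _ h3.ne'
  linarith

/-! ### The law of the sign vector -/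

lemma measurableSet_signVec_eq {d : ℕ} (η : SignVec d) :
    MeasurableSet {x : Fin d → ℝ | signVec x = η} := by
  have : {x : Fin d → ℝ | signVec x = η} = ⋂ j, {x | SignType.sign (x j) = η j} := by
    ext x
    simp [signVec, funext_iff]
  rw [this]
  refine MeasurableSet.iInter fun j => ?_
  rcases h : η j with _ | _ | _
  · have : {x : Fin d → ℝ | SignType.sign (x j) = SignType.zero} = {x | x j = 0} := by
      ext x; exact sign_eq_zero_iff
    rw [this]
    exact measurableSet_eq_fun (measurable_pi_apply j) measurable_const
  · have : {x : Fin d → ℝ | SignType.sign (x j) = SignType.neg} = {x | x j < 0} := by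
      ext x; exact sign_eq_neg_one_iff
    rw [this]
    exact measurableSet_lt (measurable_pi_apply j) measurable_const
  · have : {x : Fin d → ℝ | SignType.sign (x j) = SignType.pos} = {x | 0 < x j} := by
      ext x; exact sign_eq_one_iff
    rw [this]
    exact measurableSet_lt measurable_const (measurable_pi_apply j)

lemma sgnMass_nonneg {d : ℕ} (μ : Measure (Fin d → ℝ)) (η : SignVec d) : 0 ≤ sgnMass μ η :=
  measureReal_nonneg

lemma sum_sgnMass {d : ℕ} (μ : Measure (Fin d → ℝ)) [IsProbabilityMeasure μ] :
    ∑ η, sgnMass μ η = 1 := by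
  have := sum_measureReal_preimage_singleton (μ := μ) (f := signVec) Finset.univ
    (fun η _ => measurableSet_signVec_eq η)
  simp only [Finset.coe_univ, Set.preimage_univ, probReal_univ] at this
  exact this

lemma zeroNorm_lt_iff {d : ℕ} (x : Fin d → ℝ) : zeroNorm x < d ↔ ∃ j, x j = 0 := by
  classical
  unfold zeroNorm
  rw [Nat.card_eq_fintype_card]
  constructor
  · intro h
    by_contra! hx
    have : Fintype.card {j : Fin d // x j ≠ 0} = Fintype.card (Fin d) := by
      rw [Fintype.card_subtype]
      simp [hx]
    simp [this] at h
  · rintro ⟨j, hj⟩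
    simpa using Fintype.card_subtype_lt (p := fun j => x j ≠ 0) (x := j) (by simpa using hj)

lemma signVec_mem_fullSigns_iff {d : ℕ} (x : Fin d → ℝ) :
    signVec x ∈ fullSigns d ↔ ¬ zeroNorm x < d := by
  rw [zeroNorm_lt_iff]
  simp [fullSigns, signVec, sign_eq_zero_iff]

lemma isMCH_iff_sgnMass {d : ℕ} (μ : Measure (Fin d → ℝ)) [IsProbabilityMeasure μ] :
    IsMCH μ ↔ ∀ η ∉ fullSigns d, sgnMass μ η = 0 := by
  constructor
  · rintro ⟨-, h⟩ η hη
    refine (measureReal_eq_zero_iff).2 (measure_mono_null ?_ h)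
    rintro x rfl
    exact not_not.1 (mt (signVec_mem_fullSigns_iff x).2 hη)
  · intro h
    refine ⟨inferInstance, measure_mono_null (t := ⋃ η : {η // η ∉ fullSigns d},
      {x | signVec x = η}) ?_ (measure_iUnion_null fun η => ?_)⟩
    · intro x hx
      exact Set.mem_iUnion.2 ⟨⟨signVec x, fun h => (signVec_mem_fullSigns_iff x).1 h hx⟩, rfl⟩
    · exact (measureReal_eq_zero_iff).1 (h η η.2)

lemma ElementaryOp.sum_le {d : ℕ} {μ lam : Measure (Fin d → ℝ)} (h : ElementaryOp μ lam)
    (G : SignVec d → ℝ) (hG : ∀ a b, SignLE a b → G a ≤ G b) :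
    ∑ η, sgnMass μ η * G η ≤ ∑ η, sgnMass lam η * G η := by
  obtain ⟨-, -, q, hq, η, η', -, hle, hrest, -, h1, h2⟩ := h
  -- Nothing in the definition excludes `η = η'`; the two mass equations then force `q = 0`.
  by_cases hη : η = η'
  · subst hη
    have hq0 : q = 0 := by linarith
    refine le_of_eq (Finset.sum_congr rfl fun γ _ => ?_)
    by_cases hγ : γ = η
    · subst hγ; rw [h1, hq0, sub_zero]
    · rw [hrest γ hγ hγ]
  · have h3 : ∀ γ, sgnMass lam γ = sgnMass μ γ - (if γ = η then q else 0)
        + (if γ = η' then q else 0) := by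
      intro γ
      by_cases ha : γ = η
      · subst ha; simp [h1, hη]
      · by_cases hb : γ = η'
        · subst hb; simp [h2, ha]
        · simp [ha, hb, hrest γ ha hb]
    simp only [h3, add_mul, sub_mul, Finset.sum_add_distrib, Finset.sum_sub_distrib, ite_mul,
      zero_mul, Finset.sum_ite_eq', Finset.mem_univ, if_true]
    nlinarith [hG η η' hle]

lemma MCHLE.sum_le {d : ℕ} {μ ν : Measure (Fin d → ℝ)} (h : MCHLE μ ν)
    (G : SignVec d → ℝ) (hG : ∀ a b, SignLE a b → G a ≤ G b) :
    ∑ η, sgnMass μ η * G η ≤ ∑ η, sgnMass ν η * G η := by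
  induction h with
  | refl => exact le_rfl
  | tail _ h ih => exact ih.trans (h.sum_le G hG)

/-! ### Every law precedes an MCH law -/

/-- A discrete measure with prescribed sign masses. -/
def signMeasure {d : ℕ} (m : SignVec d → ℝ) : Measure (Fin d → ℝ) :=
  ∑ η, ENNReal.ofReal (m η) • Measure.dirac (fun j => (η j : ℝ))

lemma signVec_coe {d : ℕ} (η : SignVec d) : signVec (fun j => (η j : ℝ)) = η := by
  funext j
  rcases h : η j with _ | _ | _ <;> simp [signVec, h]

lemma isProbabilityMeasure_signMeasure {d : ℕ} {m : SignVec d → ℝ} (hm : ∀ η, 0 ≤ m η)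
    (hm1 : ∑ η, m η = 1) : IsProbabilityMeasure (signMeasure m) := by
  constructor
  simp [signMeasure, ← ENNReal.ofReal_sum_of_nonneg fun η _ => hm η, hm1]

lemma sgnMass_signMeasure {d : ℕ} {m : SignVec d → ℝ} (hm : ∀ η, 0 ≤ m η) (η : SignVec d) :
    sgnMass (signMeasure m) η = m η := by
  classical
  have : signMeasure m {x | signVec x = η} = ENNReal.ofReal (m η) := by
    simp only [signMeasure, Measure.coe_finsetSum, Finset.sum_apply, Measure.smul_apply,
      Measure.dirac_apply' _ (measurableSet_signVec_eq η), smul_eq_mul]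
    rw [Finset.sum_eq_single η]
    · simp [signVec_coe]
    · intro γ _ hγ
      simp [signVec_coe, hγ]
    · simp
  rw [sgnMass, measureReal_def, this, ENNReal.toReal_ofReal (hm η)]

/-- Needed because a real `sInf` over the empty set would be `0` and carry no information. Sign
vectors with a zero entry are emptied one at a time, their mass going to the vector with zeros
replaced by `1`; only sign masses matter, so atoms at sign vectors suffice. -/
lemma exists_isMCH_mchle {d : ℕ} (μ : Measure (Fin d → ℝ)) [IsProbabilityMeasure μ] :
    ∃ ν, IsMCH ν ∧ MCHLE μ ν := by
  classical
  suffices h : ∀ (T : Finset (SignVec d)) (μ : Measure (Fin d → ℝ)), IsProbabilityMeasure μ →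
      (∀ η ∉ fullSigns d, η ∉ T → sgnMass μ η = 0) → ∃ ν, IsMCH ν ∧ MCHLE μ ν from
    h Finset.univ μ inferInstance (by simp)
  intro T
  induction T using Finset.induction with
  | empty =>
    intro μ hμ h
    exact ⟨μ, (isMCH_iff_sgnMass μ).2 fun η hη => h η hη (by simp), Relation.ReflTransGen.refl⟩
  | insert η T _ ih =>
    intro μ hμ h
    by_cases hη : η ∈ fullSigns d
    · refine ih μ hμ fun γ hγ hγT => h γ hγ ?_
      simp only [Finset.mem_insert, hγT, or_false]
      rintro rfl
      exact hγ hη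
    · set η' : SignVec d := fun j => if η j = 0 then 1 else η j with hη'
      have hfull : η' ∈ fullSigns d := by
        intro j
        simp only [hη']
        split_ifs with h0
        · decide
        · exact h0
      have hne : η ≠ η' := fun h => hη (h ▸ hfull)
      have hle : SignLE η η' := by
        refine ⟨fun j hj => by simp [hη', hj], fun j hj => ?_⟩
        rw [hj]
        simp
      set m : SignVec d → ℝ := fun γ => sgnMass μ γ - (if γ = η then sgnMass μ η else 0)
        + (if γ = η' then sgnMass μ η else 0) with hm
      have hm0 : ∀ γ, 0 ≤ m γ := by
        intro γ
        have h1 := sgnMass_nonneg μ γ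
        have h2 := sgnMass_nonneg μ η
        simp only [hm]
        by_cases ha : γ = η
        · subst ha; simp [hne]
        · by_cases hb : γ = η'
          · subst hb; simp [ha]; linarith
          · simp [ha, hb, h1]
      have hm1 : ∑ γ, m γ = 1 := by
        simp [hm, Finset.sum_add_distrib, Finset.sum_sub_distrib, sum_sgnMass μ]
      have hprob := isProbabilityMeasure_signMeasure hm0 hm1
      have hop : ElementaryOp μ (signMeasure m) := by
        refine ⟨hμ, hprob, sgnMass μ η, sgnMass_nonneg μ η, η, η', hη, hle, ?_, le_rfl, ?_, ?_⟩
        · intro γ ha hb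
          rw [sgnMass_signMeasure hm0]; simp [hm, ha, hb]
        · rw [sgnMass_signMeasure hm0]; simp [hm, hne]
        · rw [sgnMass_signMeasure hm0]; simp [hm, hne.symm]
      obtain ⟨ν, hν, hle'⟩ := ih (signMeasure m) hprob (by
        intro γ hγ hγT
        rw [sgnMass_signMeasure hm0]
        have hb : γ ≠ η' := fun h => hγ (h ▸ hfull)
        by_cases ha : γ = η
        · subst ha; simp [hm, hne]
        · simp [hm, ha, hb, h γ hγ (by simp [ha, hγT])])
      exact ⟨ν, hν, Relation.ReflTransGen.head hop hle'⟩

/-! ### The miscoverage bound in terms of the orthant median bias -/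

lemma orthantBias_nonneg {d : ℕ} (ν : Measure (Fin d → ℝ)) : 0 ≤ orthantBias ν :=
  mul_nonneg (by positivity) (le_max_right _ _)

/-- A closed orthant exceeds its open part only by points with a zero coordinate, which are null for
an MCH law. -/
lemma IsMCH.le_sgnMass {d : ℕ} {ν : Measure (Fin d → ℝ)} (hν : IsMCH ν) {η : SignVec d}
    (hη : η ∈ fullSigns d) :
    1 / 2 ^ d - orthantBias ν / 2 ^ (d - 1) ≤ sgnMass ν η := by
  have := hν.1
  have h1 : ν.real (orthant η) ≤ sgnMass ν η := by
    have hsub : orthant η ⊆ {x | signVec x = η} ∪ {x | zeroNorm x < d} := by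
      intro x hx
      by_cases h0 : zeroNorm x < d
      · exact Or.inr h0
      · refine Or.inl (funext fun j => ?_)
        have hxj : x j ≠ 0 := fun h => h0 ((zeroNorm_lt_iff x).2 ⟨j, h⟩)
        have hj := hx j
        have hη0 := hη j
        simp only [signVec]
        rcases h : η j with _ | _ | _
        · exact absurd h hη0
        · rw [h] at hj
          simp at hj
          exact sign_neg (lt_of_le_of_ne hj hxj)
        · rw [h] at hj
          simp at hj
          exact sign_pos (lt_of_le_of_ne hj hxj.symm)
    refine (measureReal_mono hsub).trans ((measureReal_union_le _ _).trans (le_of_eq ?_))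
    rw [(measureReal_eq_zero_iff).2 hν.2, add_zero, sgnMass]
  have h2 : ⨅ η : fullSigns d, ν.real (orthant (η : SignVec d)) ≤ ν.real (orthant η) :=
    ciInf_le (Set.finite_range _).bddBelow (⟨η, hη⟩ : fullSigns d)
  have h3 := le_max_left
    (1 / 2 ^ d - ⨅ η : fullSigns d, ν.real (orthant (η : SignVec d)) : ℝ) 0
  have h4 : orthantBias ν / 2 ^ (d - 1)
      = max (1 / 2 ^ d - ⨅ η : fullSigns d, ν.real (orthant (η : SignVec d)) : ℝ) 0 := by
    rw [orthantBias]; field_simp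
  rw [h4]
  linarith

lemma tupleSum_signMissInd_le_of_omb_le {d B : ℕ} (hd : 1 ≤ d) (hB : 1 ≤ B)
    (μ : Measure (Fin d → ℝ)) [IsProbabilityMeasure μ] (δ : ℝ) (hδ : OMB μ ≤ δ) :
    tupleSum B (sgnMass μ) signMissInd
      ≤ upperU B 0 d + 2 ^ (d - 1) * (B : ℝ) * ((B : ℝ) - 1) * δ ^ 2 := by
  have hB' : (1 : ℝ) ≤ B := by exact_mod_cast hB
  rw [upperU_zero]
  -- The infimum defining `OMB` need not be attained, so the bound is proved at `δ + ε` and passed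
  -- to the limit.
  have hε : ∀ ε > 0, tupleSum B (sgnMass μ) signMissInd
      ≤ 1 - (1 - 2 * (1 / 2) ^ B) ^ d
        + 2 ^ (d - 1) * (B : ℝ) * ((B : ℝ) - 1) * (δ + ε) ^ 2 := by
    intro ε hε
    obtain ⟨ν₀, hν₀, hle₀⟩ := exists_isMCH_mchle μ
    obtain ⟨r, ⟨ν, hν, hle, rfl⟩, hr⟩ := exists_lt_of_csInf_lt
      (s := {r : ℝ | ∃ ν : Measure (Fin d → ℝ), IsMCH ν ∧ MCHLE μ ν ∧ r = orthantBias ν})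
      ⟨_, ν₀, hν₀, hle₀, rfl⟩ (lt_of_le_of_lt hδ (lt_add_of_pos_right δ hε))
    have := hν.1
    calc tupleSum B (sgnMass μ) signMissInd ≤ tupleSum B (sgnMass ν) signMissInd :=
          tupleSum_mono_mass SignLE _ _ (sgnMass_nonneg μ) (sgnMass_nonneg ν)
            (fun G hG => hle.sum_le G hG) B _ signMissInd_update_le
      _ ≤ _ := tupleSum_signMissInd_le hd hB _ (sgnMass_nonneg ν)
            ((isMCH_iff_sgnMass ν).1 hν) (sum_sgnMass ν) (orthantBias ν)
            fun η hη => hν.le_sgnMass hη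
      _ ≤ _ := by
          have := pow_le_pow_left₀ (orthantBias_nonneg ν) hr.le 2
          have h2 : (0 : ℝ) ≤ 2 ^ (d - 1) * (B : ℝ) * ((B : ℝ) - 1) :=
            mul_nonneg (by positivity) (by linarith)
          linarith [mul_le_mul_of_nonneg_left this h2]
  have hlim : Filter.Tendsto (fun ε : ℝ => 1 - (1 - 2 * (1 / 2) ^ B) ^ d
        + 2 ^ (d - 1) * (B : ℝ) * ((B : ℝ) - 1) * (δ + ε) ^ 2) (nhdsWithin 0 (Set.Ioi 0))
      (nhds (1 - (1 - 2 * (1 / 2) ^ B) ^ d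
        + 2 ^ (d - 1) * (B : ℝ) * ((B : ℝ) - 1) * (δ + 0) ^ 2)) :=
    tendsto_nhdsWithin_of_tendsto_nhds (Continuous.tendsto (by fun_prop) 0)
  rw [add_zero] at hlim
  exact ge_of_tendsto hlim (by filter_upwards [self_mem_nhdsWithin] with ε h using hε ε h)

/-! ### The rectangular hull and signs -/

/-- Over a nonempty finite family the extrema are attained, so a miss means strict inequality on one
side for every `k`. -/
lemma notMem_rectHull_iff {d B : ℕ} (hB : 1 ≤ B) (θ : Fin B → Fin d → ℝ) (θ₀ : Fin d → ℝ) :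
    θ₀ ∉ rectHull θ ↔ SignMiss fun k => signVec (θ k - θ₀) := by
  have : Nonempty (Fin B) := ⟨⟨0, hB⟩⟩
  have hinf : ∀ j, ⨅ k, θ k j ≤ θ₀ j ↔ ¬ ∀ k, θ₀ j < θ k j := by
    intro j
    push Not
    constructor
    · intro h
      obtain ⟨k, hk⟩ := exists_eq_ciInf_of_finite (f := fun k => θ k j)
      exact ⟨k, hk.trans_le h⟩
    · rintro ⟨k, hk⟩
      exact (ciInf_le (Set.finite_range _).bddBelow k).trans hk
  have hsup : ∀ j, θ₀ j ≤ ⨆ k, θ k j ↔ ¬ ∀ k, θ k j < θ₀ j := by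
    intro j
    push Not
    constructor
    · intro h
      obtain ⟨k, hk⟩ := exists_eq_ciSup_of_finite (f := fun k => θ k j)
      exact ⟨k, h.trans_eq hk.symm⟩
    · rintro ⟨k, hk⟩
      exact hk.trans (le_ciSup (Set.finite_range fun k => θ k j).bddAbove k)
  simp only [rectHull, Set.mem_univ_pi, Set.mem_Icc, hinf, hsup, SignMiss, signVec,
    sign_eq_one_iff, sign_eq_neg_one_iff, Pi.sub_apply, sub_pos, sub_neg]
  rw [not_forall]
  exact exists_congr fun j => by tauto

lemma signVec_preimage_singleton {d B : ℕ} (s : Fin B → SignVec d) :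
    (fun (θ : Fin B → Fin d → ℝ) k => signVec (θ k)) ⁻¹' {s}
      = Set.univ.pi fun k => {x | signVec x = s k} := by
  ext θ
  simp [funext_iff]

lemma measurableSet_signVec_preimage {d B : ℕ} (s : Fin B → SignVec d) :
    MeasurableSet ((fun (θ : Fin B → Fin d → ℝ) k => signVec (θ k)) ⁻¹' {s}) := by
  rw [signVec_preimage_singleton]
  exact MeasurableSet.univ_pi fun k => measurableSet_signVec_eq (s k)

lemma measurableSet_signMiss {d B : ℕ} :
    MeasurableSet {θ : Fin B → Fin d → ℝ | SignMiss fun k => signVec (θ k)} := by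
  have : {θ : Fin B → Fin d → ℝ | SignMiss fun k => signVec (θ k)}
      = ⋃ s : {s : Fin B → SignVec d // SignMiss s},
        (fun (θ : Fin B → Fin d → ℝ) k => signVec (θ k)) ⁻¹' {s.1} := by
    ext θ
    simp
  rw [this]
  exact MeasurableSet.iUnion fun s => measurableSet_signVec_preimage s.1

lemma pi_real_signMiss {d B : ℕ} (μ : Measure (Fin d → ℝ)) [IsProbabilityMeasure μ] :
    (Measure.pi fun _ : Fin B => μ).real {θ | SignMiss fun k => signVec (θ k)}
      = tupleSum B (sgnMass μ) signMissInd := by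
  classical
  have h := sum_measureReal_preimage_singleton (μ := Measure.pi fun _ : Fin B => μ)
    (f := fun (θ : Fin B → Fin d → ℝ) k => signVec (θ k))
    (Finset.univ.filter SignMiss) (fun s _ => measurableSet_signVec_preimage s)
  have h2 : (fun (θ : Fin B → Fin d → ℝ) k => signVec (θ k)) ⁻¹'
      ((Finset.univ.filter SignMiss : Finset (Fin B → SignVec d)) : Set (Fin B → SignVec d))
      = {θ | SignMiss fun k => signVec (θ k)} := by
    ext θ
    simp
  rw [h2] at h
  rw [← h, Finset.sum_filter]
  refine Finset.sum_congr rfl fun s _ => ?_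
  split_ifs with hs
  · rw [signMissInd_of_signMiss hs, mul_one, signVec_preimage_singleton, measureReal_def,
      Measure.pi_pi, ENNReal.toReal_prod]
    rfl
  · rw [signMissInd_of_not_signMiss hs, mul_zero]

/-! ### The law of the batch estimators -/

section law

variable {𝒳 Ω : Type*} [MeasurableSpace 𝒳] [MeasurableSpace Ω]

/-- The law of the centred estimator computed from `m` observations. -/
def estimatorLaw {d : ℕ} (P : Measure 𝒳) (A : (m : ℕ) → (Fin m → 𝒳) → Fin d → ℝ)
    (θ₀ : Fin d → ℝ) (m : ℕ) : Measure (Fin d → ℝ) :=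
  (Measure.pi fun _ : Fin m => P).map fun y => A m y - θ₀

lemma isProbabilityMeasure_estimatorLaw {d : ℕ} (P : Measure 𝒳) [IsProbabilityMeasure P]
    {A : (m : ℕ) → (Fin m → 𝒳) → Fin d → ℝ} (hA : ∀ m, Measurable (A m))
    (θ₀ : Fin d → ℝ) (m : ℕ) : IsProbabilityMeasure (estimatorLaw P A θ₀ m) :=
  Measure.isProbabilityMeasure_map ((hA m).sub_const θ₀).aemeasurable

lemma measurable_batchEstimator_sub {d n : ℕ} {A : (m : ℕ) → (Fin m → 𝒳) → Fin d → ℝ}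
    (hA : ∀ m, Measurable (A m)) (θ₀ : Fin d → ℝ) (σ : Equiv.Perm (Fin n)) (b : ℕ) :
    Measurable fun (x : Fin n → 𝒳) (j : Fin b) => batchEstimator A x σ b j - θ₀ := by
  unfold batchEstimator
  refine measurable_pi_lambda _ fun j => ((hA _).comp ?_).sub_const θ₀
  exact measurable_pi_lambda _ fun i => measurable_pi_apply _

lemma blockIndex_injective (n b : ℕ) :
    Function.Injective fun p : Fin b × Fin (n / b) => blockIndex n b p.1 p.2 := by
  intro p q h
  exact finProdFinEquiv.injective (Fin.castLE_injective _ h)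

lemma pi_map_batchEstimator {d n : ℕ} (P : Measure 𝒳) [IsProbabilityMeasure P]
    {A : (m : ℕ) → (Fin m → 𝒳) → Fin d → ℝ} (hA : ∀ m, Measurable (A m)) (θ₀ : Fin d → ℝ)
    (σ : Equiv.Perm (Fin n)) (b : ℕ) :
    (Measure.pi fun _ : Fin n => P).map
        (fun x (j : Fin b) => batchEstimator A x σ b j - θ₀)
      = Measure.pi fun _ => estimatorLaw P A θ₀ (n / b) := by
  have hinj : Function.Injective fun p : Fin b × Fin (n / b) => σ (blockIndex n b p.1 p.2) :=
    σ.injective.comp (blockIndex_injective n b)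
  have hm : Measurable fun y : Fin (n / b) → 𝒳 => A (n / b) y - θ₀ := (hA _).sub_const θ₀
  have := isProbabilityMeasure_estimatorLaw P hA θ₀ (n / b)
  -- Selecting distinct coordinates, grouping them into blocks and applying the estimator blockwise
  -- each carry a product measure to a product measure.
  have h1 := Measure.map_infinitePi_infinitePi_of_inj (P := fun _ : Fin n => P) hinj
  have h2 := Measure.infinitePi_map_curry (fun (_ : Fin b) (_ : Fin (n / b)) => P)
  have h3 := Measure.infinitePi_map_pi (fun _ : Fin b => Measure.infinitePi
    fun _ : Fin (n / b) => P) (fun _ => hm)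
  rw [← h2, ← h1, Measure.map_map (by fun_prop) (by fun_prop),
    Measure.map_map (by fun_prop) (by fun_prop)] at h3
  simp only [Measure.infinitePi_eq_pi] at h3
  exact h3.trans (Measure.infinitePi_eq_pi (μ := fun _ => estimatorLaw P A θ₀ (n / b)))

/-- The probability of an event that depends on `X` and on a discrete function of `Y`, for
independent `X` and `Y`. -/
lemma _root_.ProbabilityTheory.IndepFun.measure_mem_comp {α β ι : Type*} [MeasurableSpace α]
    [MeasurableSpace β] [Fintype ι] {Pr : Measure Ω} {X : Ω → α} {Y : Ω → β}
    (h : IndepFun X Y Pr) (hX : Measurable X) (hY : Measurable Y) (φ : β → ι)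
    (hφ : ∀ w, MeasurableSet (φ ⁻¹' {w})) (E : ι → Set α) (hE : ∀ w, MeasurableSet (E w)) :
    Pr {ω | X ω ∈ E (φ (Y ω))} = ∑ w, Pr (Y ⁻¹' (φ ⁻¹' {w})) * Pr (X ⁻¹' E w) := by
  have h1 : {ω | X ω ∈ E (φ (Y ω))} = ⋃ w, X ⁻¹' E w ∩ Y ⁻¹' (φ ⁻¹' {w}) := by
    ext ω
    simp
  rw [h1, measure_iUnion, tsum_fintype]
  · refine Finset.sum_congr rfl fun w _ => ?_
    rw [h.measure_inter_preimage_eq_mul _ _ (hE w) (hφ w), mul_comm]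
  · intro w w' hw
    refine Set.disjoint_left.2 fun ω h1 h2 => hw ?_
    exact h1.2.symm.trans h2.2
  · exact fun w => (hX (hE w)).inter (hY (hφ w))

/-- Every fixed permutation gives the same law, so an independent random one does too. This turns
the bias hypothesis on random batches into one on `estimatorLaw`. -/
lemma map_batchEstimator_random {d n : ℕ} (Pr : Measure Ω) [IsProbabilityMeasure Pr]
    (P : Measure 𝒳) [IsProbabilityMeasure P]
    {A : (m : ℕ) → (Fin m → 𝒳) → Fin d → ℝ} (hA : ∀ m, Measurable (A m)) (θ₀ : Fin d → ℝ)
    (X : Ω → Fin n → 𝒳) (hX : Measurable X) (hXP : Pr.map X = Measure.pi fun _ => P)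
    (σ : Ω → Equiv.Perm (Fin n)) (hσ : Measurable σ) (hindep : IndepFun X σ Pr)
    (b : ℕ) (j : Fin b) :
    Pr.map (fun ω => batchEstimator A (X ω) (σ ω) b j - θ₀) = estimatorLaw P A θ₀ (n / b) := by
  have := isProbabilityMeasure_estimatorLaw P hA θ₀ (n / b)
  have hmeas : ∀ τ, Measurable fun x : Fin n → 𝒳 => batchEstimator A x τ b j - θ₀ :=
    fun τ => (measurable_pi_apply j).comp (measurable_batchEstimator_sub hA θ₀ τ b)
  have hpair : Measurable fun p : (Fin n → 𝒳) × Equiv.Perm (Fin n) =>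
      batchEstimator A p.1 p.2 b j - θ₀ := measurable_from_prod_countable_left hmeas
  ext S hS
  have hcomp : Measurable fun ω => batchEstimator A (X ω) (σ ω) b j - θ₀ :=
    hpair.comp (hX.prodMk hσ)
  rw [Measure.map_apply hcomp hS]
  have h1 := hindep.measure_mem_comp hX hσ id (fun _ => trivial)
    (fun τ => {x | batchEstimator A x τ b j - θ₀ ∈ S}) (fun τ => hmeas τ hS)
  have h2 : ∀ τ, Pr (X ⁻¹' {x | batchEstimator A x τ b j - θ₀ ∈ S})
      = estimatorLaw P A θ₀ (n / b) S := by
    intro τ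
    have hE : MeasurableSet {x | batchEstimator A x τ b j - θ₀ ∈ S} := hmeas τ hS
    rw [← Measure.map_apply hX hE, hXP]
    have h3 := (measurePreserving_eval (fun _ : Fin b => estimatorLaw P A θ₀ (n / b)) j).map_eq
    rw [← pi_map_batchEstimator P hA θ₀ τ b, Measure.map_map (measurable_pi_apply j)
      (measurable_batchEstimator_sub hA θ₀ τ b)] at h3
    rw [← h3, Measure.map_apply]
    · rfl
    · exact hmeas τ
    · exact hS
  refine h1.trans ?_
  simp only [h2, ← Finset.sum_mul]
  have h4 : ∑ τ, Pr (σ ⁻¹' (id ⁻¹' {τ})) = 1 := by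
    have := sum_measure_preimage_singleton (μ := Pr) (f := σ) Finset.univ
      (fun τ _ => hσ trivial)
    simpa using this
  rw [h4, one_mul]

end law

end OrthantHulC

end

/-! ### Conditioning on the number of batches and the permutation -/

open OrthantHulC

theorem mainTheorem4 {𝒳 Ω : Type*} [MeasurableSpace 𝒳] [MeasurableSpace Ω]
    (Pr : Measure Ω) [IsProbabilityMeasure Pr] (P : Measure 𝒳) [IsProbabilityMeasure P]
    (d n : ℕ) (hd : 1 ≤ d) (α : ℝ) (hα0 : 0 < α) (hα1 : α < 1)
    (A : (m : ℕ) → (Fin m → 𝒳) → Fin d → ℝ) (hA : ∀ m, Measurable (A m))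
    (θ₀ : Fin d → ℝ)
    (X : Fin n → Ω → 𝒳) (hX : ∀ i, Measurable (X i)) (hXP : ∀ i, Pr.map (X i) = P)
    (hXindep : iIndepFun X Pr)
    (U : Ω → ℝ) (hU : Measurable U) (hUunif : Pr.map U = volume.restrict (Set.Icc (0 : ℝ) 1))
    (σ : Ω → Equiv.Perm (Fin n)) (hσ : Measurable σ)
    (hindep : IndepFun (fun ω i => X i ω) (fun ω => (U ω, σ ω)) Pr)
    (δ : ℝ)
    (hδ : ∀ b : ℕ, Pr {ω | OrthantHulC.Bstar α d (U ω) = b} ≠ 0 → ∀ j : Fin b,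
      OrthantHulC.OMB (Pr.map fun ω =>
        OrthantHulC.batchEstimator A (fun i => X i ω) (σ ω) b j - θ₀) ≤ δ) :
    Pr.real {ω | θ₀ ∉ OrthantHulC.confRegion α A (fun i => X i ω) (U ω) (σ ω)} ≤
      α + 2 ^ (d - 1) * (OrthantHulC.numBatches α d : ℝ)
        * ((OrthantHulC.numBatches α d : ℝ) - 1) * δ ^ 2 := by
  have hXm : Measurable fun ω i => X i ω := measurable_pi_lambda _ hX
  have hXlaw : Pr.map (fun ω i => X i ω) = Measure.pi fun _ => P := by
    rw [(iIndepFun_iff_map_fun_eq_pi_map fun i => (hX i).aemeasurable).1 hXindep]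
    simp [hXP]
  have hXσ : IndepFun (fun ω i => X i ω) σ Pr := hindep.comp measurable_id measurable_snd
  obtain ⟨hB2, -, -⟩ := two_le_numBatches_and_upperU hα0 hα1 hd
  obtain ⟨⟨hτ0, hτ1⟩, hτα⟩ := tau_mem_Icc hα0 hα1 hd
  set B := numBatches α d with hB
  set t := tau α d with ht
  set bb : Bool → ℕ := fun c => if c then B - 1 else B with hbb
  have hbb1 : ∀ c, 1 ≤ bb c := by
    intro c
    cases c
    · simp only [hbb]; simp; omega
    · simp only [hbb]; simp; omega
  have hbbB : ∀ c, bb c ≤ B := by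
    intro c
    cases c <;> simp [hbb]
  have hBstar : ∀ u, Bstar α d u = bb (decide (u ≤ t)) := by
    intro u
    simp [Bstar, hbb, ← ht, ← hB]
  set D : ℝ := 2 ^ (d - 1) * (B : ℝ) * ((B : ℝ) - 1) * δ ^ 2 with hD
  set C : Bool → Set Ω := fun c => {ω | decide (U ω ≤ t) = c} with hC
  have hCm : ∀ c, MeasurableSet {u : ℝ | decide (u ≤ t) = c} := by
    intro c
    cases c
    · have : {u : ℝ | decide (u ≤ t) = false} = Set.Ioi t := by ext; simp
      rw [this]
      exact measurableSet_Ioi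
    · have : {u : ℝ | decide (u ≤ t) = true} = Set.Iic t := by ext; simp
      rw [this]
      exact measurableSet_Iic
  have hμ : ∀ m, IsProbabilityMeasure (estimatorLaw P A θ₀ m) :=
    isProbabilityMeasure_estimatorLaw P hA θ₀
  have hbound : ∀ c, Pr (C c) ≠ 0 →
      tupleSum (bb c) (sgnMass (estimatorLaw P A θ₀ (n / bb c))) signMissInd
        ≤ upperU (bb c) 0 d + D := by
    intro c hc
    have hc' : Pr {ω | Bstar α d (U ω) = bb c} ≠ 0 := by
      refine fun h => hc (measure_mono_null ?_ h)
      rintro ω rfl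
      exact hBstar _
    have h1 := hδ (bb c) hc' ⟨0, hbb1 c⟩
    rw [map_batchEstimator_random Pr P hA θ₀ _ hXm hXlaw σ hσ hXσ] at h1
    refine (tupleSum_signMissInd_le_of_omb_le hd (hbb1 c) _ δ h1).trans ?_
    have h2 : (bb c : ℝ) ≤ B := by exact_mod_cast hbbB c
    have h3 : (1 : ℝ) ≤ bb c := by exact_mod_cast hbb1 c
    -- Both batch counts are charged the error term of the larger one, so that `D` factors out of
    -- the mixture.
    have h4 : (bb c : ℝ) * ((bb c : ℝ) - 1) ≤ B * ((B : ℝ) - 1) :=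
      mul_le_mul h2 (by linarith) (by linarith) (by linarith)
    have h5 : (0 : ℝ) ≤ 2 ^ (d - 1) * δ ^ 2 := by positivity
    nlinarith [mul_le_mul_of_nonneg_left h4 h5]
  set E : Bool × Equiv.Perm (Fin n) → Set (Fin n → 𝒳) := fun w =>
    {x | SignMiss fun k => signVec (batchEstimator A x w.2 (bb w.1) k - θ₀)} with hE
  have hEm : ∀ w, MeasurableSet (E w) := fun w =>
    measurable_batchEstimator_sub hA θ₀ w.2 (bb w.1) measurableSet_signMiss
  have hEP : ∀ w, Pr ((fun ω i => X i ω) ⁻¹' E w) = ENNReal.ofReal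
      (tupleSum (bb w.1) (sgnMass (estimatorLaw P A θ₀ (n / bb w.1))) signMissInd) := by
    intro w
    rw [← pi_real_signMiss, ← pi_map_batchEstimator P hA θ₀ w.2, ofReal_measureReal,
      Measure.map_apply (measurable_batchEstimator_sub hA θ₀ w.2 (bb w.1)) measurableSet_signMiss,
      ← hXlaw]
    exact (Measure.map_apply hXm (hEm w)).symm
  set φ : ℝ × Equiv.Perm (Fin n) → Bool × Equiv.Perm (Fin n) :=
    fun p => (decide (p.1 ≤ t), p.2) with hφ
  have hφm : ∀ w, MeasurableSet (φ ⁻¹' {w}) := by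
    intro w
    have : φ ⁻¹' {w} = {u : ℝ | decide (u ≤ t) = w.1} ×ˢ {w.2} := by
      ext p
      simp [hφ, Prod.ext_iff]
    rw [this]
    exact (hCm w.1).prod trivial
  have hUσ : Measurable fun ω => (U ω, σ ω) := hU.prodMk hσ
  have hset : {ω | θ₀ ∉ confRegion α A (fun i => X i ω) (U ω) (σ ω)}
      = {ω | (fun i => X i ω) ∈ E (φ (U ω, σ ω))} := by
    ext ω
    simp only [Set.mem_ofPred_eq, confRegion, hE, hφ]
    rw [hBstar, notMem_rectHull_iff (hbb1 _)]
  have hsum : ∀ c, ∑ s, Pr ((fun ω => (U ω, σ ω)) ⁻¹' (φ ⁻¹' {(c, s)})) = Pr (C c) := by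
    intro c
    have h1 : ∀ s, Pr ((fun ω => (U ω, σ ω)) ⁻¹' (φ ⁻¹' {(c, s)}))
        = Pr.restrict (C c) (σ ⁻¹' {s}) := by
      intro s
      have h2 : MeasurableSet (σ ⁻¹' {s}) := hσ trivial
      rw [Measure.restrict_apply h2]
      congr 1
      ext ω
      simp [hφ, hC, and_comm]
    have h2 := sum_measure_preimage_singleton (μ := Pr.restrict (C c)) (f := σ) Finset.univ
      (fun s _ => hσ trivial)
    simp only [h1, h2]
    simp
  have hmain := hindep.measure_mem_comp hXm hUσ φ hφm E hEm
  simp only [hEP, Fintype.sum_prod_type, ← Finset.sum_mul, hsum] at hmain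
  have hPrC : ∀ c, Pr.real (C c) = if c then t else 1 - t := by
    have h1 : Pr.real (C true) = t := by
      have : C true = U ⁻¹' Set.Iic t := by ext; simp [hC]
      rw [this, measureReal_def, ← Measure.map_apply hU measurableSet_Iic, hUunif,
        Measure.restrict_apply measurableSet_Iic]
      have h2 : Set.Iic t ∩ Set.Icc 0 1 = Set.Icc 0 t := by
        ext u
        simp only [Set.mem_inter_iff, Set.mem_Iic, Set.mem_Icc]
        constructor
        · rintro ⟨h, h0, -⟩; exact ⟨h0, h⟩
        · rintro ⟨h0, h⟩; exact ⟨h, h0, h.trans hτ1⟩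
      rw [h2, Real.volume_Icc, sub_zero, ENNReal.toReal_ofReal hτ0]
    intro c
    cases c
    · have : C false = (C true)ᶜ := by ext; simp [hC]
      have hm : MeasurableSet (C true) := hU (hCm true)
      rw [this, probReal_compl_eq_one_sub hm, h1]
      simp
    · simp [h1]
  have hT0 : ∀ c, 0 ≤ tupleSum (bb c) (sgnMass (estimatorLaw P A θ₀ (n / bb c))) signMissInd :=
    fun c => Finset.sum_nonneg fun s _ =>
      mul_nonneg (Finset.prod_nonneg fun k _ => sgnMass_nonneg _ _) (signMissInd_nonneg s)
  -- The bias hypothesis is silent on a branch of probability zero, but there both sides vanish.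
  have hle : ∀ c, Pr.real (C c) *
      tupleSum (bb c) (sgnMass (estimatorLaw P A θ₀ (n / bb c))) signMissInd
        ≤ Pr.real (C c) * (upperU (bb c) 0 d + D) := by
    intro c
    by_cases hc : Pr (C c) = 0
    · simp [measureReal_def, hc]
    · exact mul_le_mul_of_nonneg_left (hbound c hc) measureReal_nonneg
  rw [hset, measureReal_def, hmain, ENNReal.toReal_sum (fun c _ =>
    ENNReal.mul_ne_top (measure_ne_top _ _) ENNReal.ofReal_ne_top)]
  simp only [ENNReal.toReal_mul, ENNReal.toReal_ofReal (hT0 _), ← measureReal_def]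
  refine (Finset.sum_le_sum fun c _ => hle c).trans (le_of_eq ?_)
  simp only [Fintype.sum_bool, hPrC, hbb]
  simp only [if_true, Bool.false_eq_true, if_false]
  rw [← hτα]
  ring
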